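/- Functions are complex-valued, on $\mathbb{R}^+=(0,\infty)$. Let $\mathcal{S}_+$ be the Schwartz class on $[0,\infty)$. For $f\in\mathcal{S}_+$ and $\gamma>0$ put $W_+^{-\gamma}f(t)=\frac{1}{\Gamma(\gamma)}\int_t^\infty (s-t)^{\gamma-1}f(s)\,ds$, and for $\alpha\ge 0$ put $W_+^{\alpha}f=(-1)^n\frac{d^n}{dt^n}W_+^{-(n-\alpha)}f$ with $n=[\alpha]+1$ (so $W_+^0f=f$). For $1\le p<\infty$ let $\mathcal{T}_p^{(\alpha)}(t^\alpha)\subset L^p(\mathbb{R}^+)$ be the completion of $\mathcal{S}_+$ in the norm $$\|f\|_{\alpha,p}=\frac{1}{\Gamma(\alpha+1)}\Big(\int_0^\infty |W_+^\alpha f(t)|^p\,t^{\alpha p}\,dt\Big)^{1/p}$$ (so $\mathcal{T}_p^{(0)}(t^0)=L^p(\mathbb{R}^+)$), to which $W_+^\alpha$ extends by continuity, and put, for $f\in\mathcal{T}_p^{(\alpha)}(t^\alpha)$ and $g\in\mathcal{T}_{p'}^{(\alpha)}(t^\alpha)$ with $\frac1p+\frac1{p'}=1$, $$\langle f,g\rangle_\alpha=\frac{1}{\Gamma(\alpha+1)^2}\int_0^\infty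 W_+^\alpha f(t)\,W_+^\alpha g(t)\,t^{2\alpha}\,dt .$$ For $\beta>0$ the generalized Cesàro operator and the generalized dual Cesàro operator are $$\mathcal{C}_\beta f(t)=\frac{\beta}{t^\beta}\int_0^t (t-s)^{\beta-1}f(s)\,ds,\qquad \mathcal{C}_\beta^* f(t)=\beta\int_t^\infty \frac{(s-t)^{\beta-1}}{s^\beta}f(s)\,ds .$$ For $r\in\mathbb{R}$ let $T_{r,p}f(t)=e^{-r/p}f(e^{-r}t)$. **Theorem.** Let $\alpha\ge 0$, $1<p<\infty$, $\beta>0$ and $\frac1p+\frac1{p'}=1$. 1. For every $f\in\mathcal{T}_p^{(\alpha)}(t^\alpha)$ the integral defining $\mathcal{C}_\beta^*f(t)$ converges absolutely for almost every $t>0$, and $\mathcal{C}_\beta^*$ is a bounded operator on $\mathcal{T}_p^{(\alpha)}(t^\alpha)$ with $$\|\mathcal{C}_\beta^*\|=\frac{\Gamma(\beta+1)\,\Gamma(1/p)}{\Gamma(\beta+1/p)} .$$ 2. For every $f\in\mathcal{T}_p^{(\alpha)}(t^\alpha)$ and almost every $t>0$, $$\mathcal{C}_\beta^* f(t)=\beta\int_{-\infty}^0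 (e^{-r}-1)^{\beta-1}e^{-r(1-1/p-\beta)}\,T_{r,p}f(t)\,dr ,$$ the integral being absolutely convergent. 3. The dual operator of $\mathcal{C}_\beta$ on $\mathcal{T}_p^{(\alpha)}(t^\alpha)$ is $\mathcal{C}_\beta^*$ on $\mathcal{T}_{p'}^{(\alpha)}(t^\alpha)$: both are bounded operators on these spaces (their integrals converging absolutely for almost every $t>0$), and $$\langle \mathcal{C}_\beta f,g\rangle_\alpha=\langle f,\mathcal{C}_\beta^* g\rangle_\alpha,\qquad f\in\mathcal{T}_p^{(\alpha)}(t^\alpha),\ g\in\mathcal{T}_{p'}^{(\alpha)}(t^\alpha).$$ -/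

import Mathlib

open MeasureTheory Set
open scoped ENNReal SchwartzMap

noncomputable section

/-- Lebesgue measure on the half-line `ℝ⁺ = (0, ∞)`. -/
abbrev halfLine : Measure ℝ := (volume : Measure ℝ).restrict (Ioi 0)

/-- The Weyl fractional integral of order `γ > 0`,
`W₊^{-γ} f (t) = Γ(γ)⁻¹ ∫_t^∞ (s - t)^(γ - 1) f(s) ds`. -/
def weylIntegral (γ : ℝ) (f : ℝ → ℂ) (t : ℝ) : ℂ :=
  ((1 / Real.Gamma γ : ℝ) : ℂ) * ∫ s in Ioi t, (((s - t) ^ (γ - 1) : ℝ) : ℂ) * f s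

/-- The Weyl fractional derivative of order `α ≥ 0`,
`W₊^α f = (-1)^n (d/dt)^n W₊^{-(n - α)} f` with `n = [α] + 1`.
For `α = 0` this gives `-(d/dt) ∫_t^∞ f = f`, so that `W₊^0` is the identity. -/
def weylDeriv (α : ℝ) (f : ℝ → ℂ) (t : ℝ) : ℂ :=
  (-1) ^ (⌊α⌋₊ + 1) *
    iteratedDeriv (⌊α⌋₊ + 1) (weylIntegral (((⌊α⌋₊ + 1 : ℕ) : ℝ) - α) f) t

/-- `D₊^α f (t) = Γ(α + 1)⁻¹ t^α W₊^α f (t)` for a function `f` of the Schwartz class. -/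
def weightedWeyl (α : ℝ) (f : ℝ → ℂ) (t : ℝ) : ℂ :=
  ((t ^ α / Real.Gamma (α + 1) : ℝ) : ℂ) * weylDeriv α f t

/-- The graph of `D₊^α` over the Schwartz class `𝒮₊` of `[0, ∞)`, in `L^p(ℝ⁺) × L^p(ℝ⁺)`.
The class `𝒮₊` consists of the restrictions to `[0, ∞)` of the Schwartz functions on `ℝ`; for
`t > 0` the value `weightedWeyl α φ t` depends only on the values of `φ` on `(0, ∞)`.
(The set below is already a linear subspace, because `W₊^α` is linear on `𝒮₊`.) -/
def schwartzGraph (α : ℝ) (p : ℝ≥0∞) [Fact (1 ≤ p)] :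
    Submodule ℂ (Lp ℂ p halfLine × Lp ℂ p halfLine) :=
  Submodule.span ℂ {w | ∃ φ : 𝓢(ℝ, ℂ),
    (w.1 : ℝ → ℂ) =ᵐ[halfLine] (φ : ℝ → ℂ) ∧
    (w.2 : ℝ → ℂ) =ᵐ[halfLine] weightedWeyl α φ}

/-- The space `𝒯_p^{(α)}(t^α)`, the completion of `𝒮₊` in the norm `‖D₊^α φ‖_p`, realised inside
`L^p(ℝ⁺)`: it consists of the `f ∈ L^p(ℝ⁺)` for which there are `φₙ ∈ 𝒮₊` and `F ∈ L^p(ℝ⁺)` with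
`φₙ → f` and `D₊^α φₙ → F` in `L^p(ℝ⁺)`. An element is recorded as the pair `(f, F)`; either
component determines the other, and `F` is the extended `D₊^α f`.
For `α = 0` this is the diagonal of `L^p(ℝ⁺)`, that is, `L^p(ℝ⁺)` itself. -/
def SobolevT (α : ℝ) (p : ℝ≥0∞) [Fact (1 ≤ p)] : Type :=
  ↥(schwartzGraph α p).topologicalClosure

namespace SobolevT

variable {α : ℝ} {p : ℝ≥0∞} [Fact (1 ≤ p)]

instance : AddCommGroup (SobolevT α p) :=
  inferInstanceAs (AddCommGroup ↥(schwartzGraph α p).topologicalClosure)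

instance : Module ℂ (SobolevT α p) :=
  inferInstanceAs (Module ℂ ↥(schwartzGraph α p).topologicalClosure)

/-- The inclusion of `𝒯_p^{(α)}(t^α)` in `L^p(ℝ⁺)`. -/
def toLp : SobolevT α p →ₗ[ℂ] Lp ℂ p halfLine :=
  (LinearMap.fst ℂ (Lp ℂ p halfLine) (Lp ℂ p halfLine)).comp
    (schwartzGraph α p).topologicalClosure.subtype

/-- The operator `D₊^α : 𝒯_p^{(α)}(t^α) → L^p(ℝ⁺)`, extending `weightedWeyl α` on `𝒮₊`. -/
def D : SobolevT α p →ₗ[ℂ] Lp ℂ p halfLine :=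
  (LinearMap.snd ℂ (Lp ℂ p halfLine) (Lp ℂ p halfLine)).comp
    (schwartzGraph α p).topologicalClosure.subtype

/-- An element of `𝒯_p^{(α)}(t^α)` is used as a function (defined almost everywhere on `ℝ⁺`). -/
instance : CoeFun (SobolevT α p) (fun _ => ℝ → ℂ) := ⟨fun f => (toLp f : ℝ → ℂ)⟩

/-- The norm `‖f‖_{α,p} = Γ(α + 1)⁻¹ (∫₀^∞ |W₊^α f(t)|^p t^(α p) dt)^(1/p) = ‖D₊^α f‖_p`. -/
instance : SeminormedAddCommGroup (SobolevT α p) :=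
  SeminormedAddCommGroup.induced (SobolevT α p) (Lp ℂ p halfLine) D

instance : NormedSpace ℂ (SobolevT α p) :=
  NormedSpace.induced ℂ (SobolevT α p) (Lp ℂ p halfLine) D

/-- The extension of `W₊^α` to `𝒯_p^{(α)}(t^α)`: `W₊^α f (t) = Γ(α + 1) t^(-α) D₊^α f (t)`. -/
def weyl (f : SobolevT α p) (t : ℝ) : ℂ :=
  ((Real.Gamma (α + 1) * t ^ (-α) : ℝ) : ℂ) * (D f : ℝ → ℂ) t

/-- The pairing `⟨f, g⟩_α = Γ(α + 1)⁻² ∫₀^∞ W₊^α f(t) W₊^α g(t) t^(2α) dt`. -/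
def pairing {q : ℝ≥0∞} [Fact (1 ≤ q)] (f : SobolevT α p) (g : SobolevT α q) : ℂ :=
  ((1 / Real.Gamma (α + 1) ^ 2 : ℝ) : ℂ) *
    ∫ t in Ioi (0 : ℝ), weyl f t * weyl g t * ((t ^ (2 * α) : ℝ) : ℂ)

/-- The bounded operator `C` on `𝒯_p^{(α)}(t^α)` is the generalized Cesàro operator `𝒞_β`: for
almost every `t > 0` the integral converges absolutely and
`C f (t) = β t^(-β) ∫₀^t (t - s)^(β - 1) f(s) ds`. -/
def IsCesaro (β : ℝ) (C : SobolevT α p →L[ℂ] SobolevT α p) : Prop :=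
  ∀ f : SobolevT α p, ∀ᵐ t ∂halfLine,
    IntegrableOn (fun s => (((t - s) ^ (β - 1) : ℝ) : ℂ) * f s) (Ioo 0 t) ∧
    C f t = ((β / t ^ β : ℝ) : ℂ) * ∫ s in Ioo 0 t, (((t - s) ^ (β - 1) : ℝ) : ℂ) * f s

/-- The bounded operator `S` on `𝒯_p^{(α)}(t^α)` is the generalized dual Cesàro operator `𝒞_β^*`:
for almost every `t > 0` the integral converges absolutely and
`S f (t) = β ∫_t^∞ (s - t)^(β - 1) s^(-β) f(s) ds`. -/
def IsDualCesaro (β : ℝ) (S : SobolevT α p →L[ℂ] SobolevT α p) : Prop :=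
  ∀ f : SobolevT α p, ∀ᵐ t ∂halfLine,
    IntegrableOn (fun s => (((s - t) ^ (β - 1) / s ^ β : ℝ) : ℂ) * f s) (Ioi t) ∧
    S f t = (β : ℂ) * ∫ s in Ioi t, (((s - t) ^ (β - 1) / s ^ β : ℝ) : ℂ) * f s

end SobolevT

/-- The group of dilations `T_{r,p} f (s) = e^(-r/p) f(e^(-r) s)`. -/
def dilation (p r : ℝ) (f : ℝ → ℂ) (s : ℝ) : ℂ :=
  ((Real.exp (-r / p) : ℝ) : ℂ) * f (Real.exp (-r) * s)

end

/-! The substitution `s = u t` turns both operators into averages of dilations, `f ↦ ∫ k(u) f(u ·)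
du`: for `𝒞_β` the weight is `β (1 - u)^(β - 1)` on `(0, 1)`, for `𝒞_β^*` it is `β (u - 1)^(β - 1)
u^(-β)` on `(1, ∞)`. Dilations commute with `D₊^α`, since the factor `u^α` produced by `W₊^α` is
absorbed by the weight `t^α` (`weightedWeyl_comp_mul_left`). An average therefore acts on a pair
`(f, D₊^α f)` componentwise and stays in the closed graph (`DilationWeight.averageLp_mem_closure`),
so norms and pairings are computed in `L^p(ℝ⁺)` as for `α = 0`.

Upper bound: `f ↦ f(u ·)` scales the `L^p` norm by `u^(-1/p)`, so Minkowski's inequality bounds the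
norm by `∫ |k(u)| u^(-1/p) du`, which for `𝒞_β^*` is a beta integral with the stated value.

Lower bound: formally, `t^(-a)` is an eigenfunction of `𝒞_β^*` with eigenvalue `κ(a) = Γ(β + 1) Γ(a)
/ Γ(β + a)`, but it is not in `L^p`. For `a > 1/p` it is replaced by the average `J(t) = ∫₀¹ u^(a -
1) F(u t) du` of the positive function `F = D₊^α e^(-t)`. Then `t^a J(t) = ∫₀^t s^(a - 1) F(s) ds`
is increasing, so `J(v t) ≥ v^(-a) J(t)` for `v ≥ 1`, and integration gives `𝒞_β^* J ≥ κ(a) J`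
pointwise (`mul_norm_powerWeight_average_le`). As `J` is itself an average, it is `D₊^α` of an
element of the space; let `a` decrease to `1/p`.

Part 2 is the substitution `u = e^(-r)`. Duality is the substitution `u ↦ 1/u`, which exchanges the
two weights (`dualCesaroWeight_inv`, `integral_averageLp_mul`). -/

noncomputable section

/-- By the Lindelöf property every open set is a countable union of balls, and preimages of balls
are sublevel sets of the distance functions. -/
theorem measurable_of_measurable_dist {ι E : Type*} [MeasurableSpace ι] [PseudoMetricSpace E]
    [SecondCountableTopology E] [MeasurableSpace E] [BorelSpace E] {φ : ι → E}
    (h : ∀ x, Measurable fun a => dist (φ a) x) : Measurable φ := by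
  refine measurable_of_isOpen fun U hU => ?_
  have hε : ∀ x : U, ∃ ε > 0, Metric.ball (x : E) ε ⊆ U := fun x =>
    Metric.isOpen_iff.1 hU x x.2
  choose ε hε hεU using hε
  obtain ⟨T, hT, hTU⟩ := TopologicalSpace.isOpen_iUnion_countable
    (fun x : U => Metric.ball (x : E) (ε x)) fun _ => Metric.isOpen_ball
  have hUeq : U = ⋃ x ∈ T, Metric.ball (x : E) (ε x) := by
    rw [hTU]
    refine Subset.antisymm (fun x hx => ?_) (iUnion_subset hεU)
    exact mem_iUnion.2 ⟨⟨x, hx⟩, Metric.mem_ball_self (hε _)⟩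
  rw [hUeq, preimage_iUnion₂]
  exact MeasurableSet.biUnion hT fun x _ => measurableSet_lt (h x) measurable_const

/-! ### Dilations on `L^p(ℝ⁺)`. -/

theorem map_mul_left_halfLine {u : ℝ} (hu : 0 < u) :
    halfLine.map (u * ·) = ENNReal.ofReal u⁻¹ • halfLine := by
  have h : (u * ·) ⁻¹' Ioi (0 : ℝ) = Ioi 0 := by
    ext t; simp [hu]
  rw [halfLine]
  conv_lhs => rw [← h]
  rw [← Measure.restrict_map (measurable_const_mul u) measurableSet_Ioi,
    Real.map_volume_mul_left hu.ne', Measure.restrict_smul, abs_of_pos (inv_pos.2 hu)]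

theorem quasiMeasurePreserving_mul_left_halfLine {u : ℝ} (hu : 0 < u) :
    Measure.QuasiMeasurePreserving (u * ·) halfLine halfLine := by
  refine ⟨measurable_const_mul u, ?_⟩
  rw [map_mul_left_halfLine hu]
  exact Measure.smul_absolutelyContinuous

theorem eLpNorm_comp_mul_left_halfLine {p : ℝ≥0∞} (hp : p ≠ ∞) {u : ℝ} (hu : 0 < u) {f : ℝ → ℂ}
    (hf : AEStronglyMeasurable f halfLine) :
    eLpNorm (fun t => f (u * t)) p halfLine =
      ENNReal.ofReal (u ^ (-(1 / p.toReal))) * eLpNorm f p halfLine := by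
  have h := eLpNorm_map_measure (p := p) (f := (u * ·)) (μ := halfLine) (g := f)
    (by rw [map_mul_left_halfLine hu]; exact hf.smul_measure _) (measurable_const_mul u).aemeasurable
  rw [map_mul_left_halfLine hu, eLpNorm_smul_measure_of_ne_top hp] at h
  rw [show (fun t => f (u * t)) = f ∘ (u * ·) from rfl, ← h, smul_eq_mul,
    ENNReal.ofReal_rpow_of_pos (inv_pos.2 hu), Real.inv_rpow hu.le, Real.rpow_neg hu.le,
    ENNReal.toReal_div, ENNReal.toReal_one]

theorem memLp_comp_mul_left_halfLine {p : ℝ≥0∞} (hp : p ≠ ∞) {u : ℝ} (hu : 0 < u) {f : ℝ → ℂ}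
    (hf : MemLp f p halfLine) : MemLp (fun t => f (u * t)) p halfLine := by
  refine ⟨hf.1.comp_quasiMeasurePreserving (quasiMeasurePreserving_mul_left_halfLine hu), ?_⟩
  rw [eLpNorm_comp_mul_left_halfLine hp hu hf.1]
  exact ENNReal.mul_lt_top ENNReal.ofReal_lt_top hf.2

variable {p : ℝ≥0∞} [Fact (1 ≤ p)] [hp : Fact (p ≠ ∞)]

variable (p) in
/-- The dilation `f ↦ f (u ·)` of `L^p(ℝ⁺)` for `u > 0`, and `0` for `u ≤ 0`. -/
def dilLp (u : ℝ) : Lp ℂ p halfLine →L[ℂ] Lp ℂ p halfLine :=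
  if hu : 0 < u then
    LinearMap.mkContinuous
      { toFun := fun f => (memLp_comp_mul_left_halfLine hp.out hu (Lp.memLp f)).toLp _
        map_add' := fun f g => by
          rw [← MemLp.toLp_add]
          exact MemLp.toLp_congr _ _
            ((quasiMeasurePreserving_mul_left_halfLine hu).ae_eq_comp (Lp.coeFn_add f g))
        map_smul' := fun c f => by
          rw [RingHom.id_apply, ← MemLp.toLp_const_smul]
          exact MemLp.toLp_congr _ _
            ((quasiMeasurePreserving_mul_left_halfLine hu).ae_eq_comp (Lp.coeFn_smul c f)) }
      (u ^ (-(1 / p.toReal))) fun f => by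
        rw [LinearMap.coe_mk, AddHom.coe_mk, Lp.norm_toLp,
          eLpNorm_comp_mul_left_halfLine hp.out hu (Lp.aestronglyMeasurable f), ENNReal.toReal_mul,
          ENNReal.toReal_ofReal (by positivity), Lp.norm_def]
  else 0

theorem coeFn_dilLp {u : ℝ} (hu : 0 < u) (f : Lp ℂ p halfLine) :
    dilLp p u f =ᵐ[halfLine] fun t => f (u * t) := by
  rw [dilLp, dif_pos hu]
  exact MemLp.coeFn_toLp (memLp_comp_mul_left_halfLine hp.out hu (Lp.memLp f))

theorem norm_dilLp {u : ℝ} (hu : 0 < u) (f : Lp ℂ p halfLine) :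
    ‖dilLp p u f‖ = u ^ (-(1 / p.toReal)) * ‖f‖ := by
  rw [Lp.norm_def, eLpNorm_congr_ae (coeFn_dilLp hu f),
    eLpNorm_comp_mul_left_halfLine hp.out hu (Lp.aestronglyMeasurable f), ENNReal.toReal_mul,
    ENNReal.toReal_ofReal (by positivity), Lp.norm_def]

theorem measurable_eLpNorm_right {f : ℝ × ℝ → ℂ} (hf : Measurable f) :
    Measurable fun u => eLpNorm (fun t => f (u, t)) p halfLine := by
  simp_rw [eLpNorm_eq_lintegral_rpow_enorm_toReal (zero_lt_one.trans_le Fact.out).ne' hp.out]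
  exact (Measurable.lintegral_prod_right' (hf.enorm.pow_const _)).pow_const _

/-- Makes the Bochner integral of dilations meaningful without proving strong continuity. For `p <
∞` the space is separable, so it suffices that distances to fixed elements are measurable in `u`;
these are parameter integrals of jointly measurable functions. -/
theorem stronglyMeasurable_dilLp (f : Lp ℂ p halfLine) :
    StronglyMeasurable fun u => dilLp p u f := by
  borelize ↥(Lp ℂ p halfLine)
  refine Measurable.stronglyMeasurable (measurable_of_measurable_dist fun h => ?_)
  have key : (fun u => dist (dilLp p u f) h) = fun u => if 0 < u then
      (eLpNorm (fun t => f (u * t) - h t) p halfLine).toReal else dist 0 h := by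
    ext u
    split_ifs with hu
    · rw [Lp.dist_def]
      congr 1
      refine eLpNorm_congr_ae ?_
      filter_upwards [coeFn_dilLp hu f] with t ht
      simp [ht]
    · rw [dilLp, dif_neg hu]; rfl
  rw [key]
  refine Measurable.ite measurableSet_Ioi ?_ measurable_const
  refine (measurable_eLpNorm_right (f := fun x : ℝ × ℝ => f (x.1 * x.2) - h x.2) ?_).ennreal_toReal
  exact ((Lp.stronglyMeasurable f).measurable.comp (measurable_fst.mul measurable_snd)).sub
    ((Lp.stronglyMeasurable h).measurable.comp measurable_snd)

end

/-! ### Averages of dilations on `L^p(ℝ⁺)`. -/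

noncomputable section

/-- Hölder's inequality against the indicator of `A`; it provides the local functionals that test
identities in `L^p`. -/
theorem setIntegral_norm_le_eLpNorm {p : ℝ≥0∞} [Fact (1 ≤ p)] {A : Set ℝ} (hA : halfLine A ≠ ∞)
    {g : ℝ → ℂ} (hg : MemLp g p halfLine) :
    IntegrableOn g A halfLine ∧ ∫ t in A, ‖g t‖ ∂halfLine ≤
      (halfLine A ^ (1 / (1 : ℝ≥0∞).toReal - 1 / p.toReal)).toReal *
        (eLpNorm g p halfLine).toReal := by
  have hA' : IsFiniteMeasure (halfLine.restrict A) := ⟨by simpa using hA.lt_top⟩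
  have hgA : MemLp g p (halfLine.restrict A) := hg.mono_measure Measure.restrict_le_self
  have hint : IntegrableOn g A halfLine := hgA.integrable Fact.out
  have hexp : (0 : ℝ) ≤ 1 / (1 : ℝ≥0∞).toReal - 1 / p.toReal := by
    have hp1 : (1 : ℝ≥0∞) ≤ p := Fact.out
    rcases eq_or_ne p ∞ with rfl | hp
    · simp
    · have : 1 ≤ p.toReal := by simpa using ENNReal.toReal_mono hp hp1
      have := inv_le_one_of_one_le₀ this
      simpa using this
  refine ⟨hint, ?_⟩
  rw [integral_norm_eq_lintegral_enorm hint.aestronglyMeasurable, ← eLpNorm_one_eq_lintegral_enorm,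
    ← ENNReal.toReal_mul, mul_comm]
  refine ENNReal.toReal_mono
    (ENNReal.mul_ne_top hg.2.ne (ENNReal.rpow_ne_top_of_nonneg hexp hA)) ?_
  refine (eLpNorm_le_eLpNorm_mul_rpow_measure_univ (Fact.out : 1 ≤ p) hgA.1).trans ?_
  rw [Measure.restrict_apply_univ]
  gcongr
  exact Measure.restrict_le_self

variable {p : ℝ≥0∞} [Fact (1 ≤ p)]

variable (p) in
/-- Integration over a set of finite measure, as a functional on `L^p(ℝ⁺)`. -/
def setIntegralLp (A : Set ℝ) (hA : halfLine A ≠ ∞) : Lp ℂ p halfLine →L[ℂ] ℂ :=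
  LinearMap.mkContinuous
    { toFun := fun f => ∫ t in A, f t ∂halfLine
      map_add' := fun f g => by
        rw [← integral_add (setIntegral_norm_le_eLpNorm hA (Lp.memLp f)).1
          (setIntegral_norm_le_eLpNorm hA (Lp.memLp g)).1]
        exact integral_congr_ae (ae_restrict_of_ae (Lp.coeFn_add f g))
      map_smul' := fun c f => by
        rw [RingHom.id_apply, ← integral_smul]
        exact integral_congr_ae (ae_restrict_of_ae (Lp.coeFn_smul c f)) }
    (halfLine A ^ (1 / (1 : ℝ≥0∞).toReal - 1 / p.toReal)).toReal fun f => by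
      rw [Lp.norm_def]
      exact (norm_integral_le_integral_norm _).trans
        (setIntegral_norm_le_eLpNorm hA (Lp.memLp f)).2

variable [hp : Fact (p ≠ ∞)] {k : ℝ → ℝ}

variable (p) in
/-- A measurable weight `k` on `ℝ⁺` with `∫ |k u| u^(-1/p) du < ∞`, so that the average
`∫ k u f (u t) du` is a bounded operator on `L^p(ℝ⁺)`. -/
structure DilationWeight (k : ℝ → ℝ) : Prop where
  measurable : Measurable k
  integrable : IntegrableOn (fun u => k u * u ^ (-(1 / p.toReal))) (Ioi 0)

theorem ae_halfLine_pos : ∀ᵐ u ∂halfLine, 0 < u := ae_restrict_mem measurableSet_Ioi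

theorem norm_smul_dilLp {u : ℝ} (hu : 0 < u) (f : Lp ℂ p halfLine) :
    ‖(k u : ℂ) • dilLp p u f‖ = ‖k u * u ^ (-(1 / p.toReal))‖ * ‖f‖ := by
  rw [norm_smul, norm_dilLp hu, norm_mul, Complex.norm_real,
    Real.norm_of_nonneg (Real.rpow_nonneg hu.le _), mul_assoc]

theorem DilationWeight.integrable_smul_dilLp (hk : DilationWeight p k) (f : Lp ℂ p halfLine) :
    Integrable (fun u => (k u : ℂ) • dilLp p u f) halfLine := by
  refine Integrable.mono' (hk.integrable.norm.mul_const ‖f‖)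
    ((Complex.measurable_ofReal.comp hk.measurable).stronglyMeasurable.smul
      (stronglyMeasurable_dilLp f)).aestronglyMeasurable ?_
  filter_upwards [ae_halfLine_pos] with u hu
  rw [norm_smul_dilLp hu]

/-- The operator `f ↦ ∫ k u f (u ·) du` on `L^p(ℝ⁺)`. -/
def DilationWeight.averageLp (hk : DilationWeight p k) : Lp ℂ p halfLine →L[ℂ] Lp ℂ p halfLine :=
  LinearMap.mkContinuous
    { toFun := fun f => ∫ u, (k u : ℂ) • dilLp p u f ∂halfLine
      map_add' := fun f g => by
        rw [← integral_add (hk.integrable_smul_dilLp f) (hk.integrable_smul_dilLp g)]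
        simp_rw [map_add, smul_add]
      map_smul' := fun c f => by
        rw [RingHom.id_apply, ← integral_smul]
        simp_rw [map_smul, smul_comm c] }
    (∫ u in Ioi 0, ‖k u * u ^ (-(1 / p.toReal))‖) fun f => by
      rw [← integral_mul_const]
      refine (norm_integral_le_integral_norm _).trans (integral_mono_ae
        (hk.integrable_smul_dilLp f).norm (hk.integrable.norm.mul_const ‖f‖) ?_)
      filter_upwards [ae_halfLine_pos] with u hu
      rw [norm_smul_dilLp hu]

theorem DilationWeight.averageLp_apply (hk : DilationWeight p k) (f : Lp ℂ p halfLine) :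
    hk.averageLp f = ∫ u, (k u : ℂ) • dilLp p u f ∂halfLine := rfl

theorem DilationWeight.norm_averageLp_le (hk : DilationWeight p k) (f : Lp ℂ p halfLine) :
    ‖hk.averageLp f‖ ≤ (∫ u in Ioi 0, ‖k u * u ^ (-(1 / p.toReal))‖) * ‖f‖ :=
  (LinearMap.mkContinuous_norm_le _ (by positivity) _ : ‖hk.averageLp‖ ≤ _) |>
    hk.averageLp.le_of_opNorm_le <| f

/-- The hypothesis of Fubini's theorem. Restricting `t` to finite measure is essential: an `L^p`
function need not be integrable on all of `ℝ⁺`. -/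
theorem DilationWeight.integrable_prod (hk : DilationWeight p k) (f : Lp ℂ p halfLine) {A : Set ℝ}
    (hA : halfLine A ≠ ∞) :
    Integrable (fun x : ℝ × ℝ => (k x.1 : ℂ) * f (x.1 * x.2))
      (halfLine.prod (halfLine.restrict A)) := by
  have hmeas : Measurable (fun x : ℝ × ℝ => (k x.1 : ℂ) * f (x.1 * x.2)) :=
    (Complex.measurable_ofReal.comp (hk.measurable.comp measurable_fst)).mul
      ((Lp.stronglyMeasurable f).measurable.comp (measurable_fst.mul measurable_snd))
  have hsl : ∀ᵐ u ∂halfLine, MemLp (fun t => f (u * t)) p halfLine := by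
    filter_upwards [ae_halfLine_pos] with u hu
    exact memLp_comp_mul_left_halfLine hp.out hu (Lp.memLp f)
  rw [integrable_prod_iff hmeas.aestronglyMeasurable]
  refine ⟨?_, ?_⟩
  · filter_upwards [hsl] with u hu
    exact (setIntegral_norm_le_eLpNorm hA hu).1.const_mul _
  · refine Integrable.mono' (((hk.integrable.norm.mul_const ‖f‖).const_mul
      (halfLine A ^ (1 / (1 : ℝ≥0∞).toReal - 1 / p.toReal)).toReal))
      hmeas.aestronglyMeasurable.norm.integral_prod_right' ?_
    filter_upwards [ae_halfLine_pos, hsl] with u hu hfu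
    rw [Real.norm_of_nonneg (by positivity)]
    simp_rw [norm_mul]
    rw [integral_const_mul, Complex.norm_real, Real.norm_of_nonneg (Real.rpow_nonneg hu.le _)]
    refine (mul_le_mul_of_nonneg_left (setIntegral_norm_le_eLpNorm hA hfu).2
      (norm_nonneg _)).trans_eq ?_
    rw [eLpNorm_comp_mul_left_halfLine hp.out hu (Lp.aestronglyMeasurable f), ENNReal.toReal_mul,
      ENNReal.toReal_ofReal (by positivity), Lp.norm_def]
    ring

theorem DilationWeight.ae_integrableOn (hk : DilationWeight p k) (f : Lp ℂ p halfLine) :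
    ∀ᵐ t ∂halfLine, IntegrableOn (fun u => (k u : ℂ) * f (u * t)) (Ioi 0) :=
  ae_of_forall_measure_lt_top_ae_restrict _ fun _ _ hA =>
    (hk.integrable_prod f hA.ne).prod_left_ae

/-- An `L^p`-valued Bochner integral has no pointwise meaning a priori. Both sides are compared
through their integrals over sets of finite measure: these are continuous functionals, which pass
inside the Bochner integral, and Fubini handles the pointwise side. -/
theorem DilationWeight.averageLp_ae_eq (hk : DilationWeight p k) (f : Lp ℂ p halfLine) :
    hk.averageLp f =ᵐ[halfLine] fun t => ∫ u in Ioi 0, (k u : ℂ) * f (u * t) := by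
  refine ae_eq_of_forall_setIntegral_eq_of_sigmaFinite
    (fun A _ hA => (setIntegral_norm_le_eLpNorm hA.ne (Lp.memLp _)).1)
    (fun A _ hA => (hk.integrable_prod f hA.ne).integral_prod_right) fun A _ hA => ?_
  rw [← integral_integral_swap (hk.integrable_prod f hA.ne)]
  change setIntegralLp p A hA.ne (hk.averageLp f) = _
  rw [hk.averageLp_apply, ← ContinuousLinearMap.integral_comp_comm _ (hk.integrable_smul_dilLp f)]
  refine integral_congr_ae ?_
  filter_upwards [ae_halfLine_pos] with u hu
  rw [map_smul, smul_eq_mul, integral_const_mul]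
  congr 1
  exact integral_congr_ae (ae_restrict_of_ae (coeFn_dilLp hu f))

end

/-! ### Dilation invariance of `D₊^α`, and averages on `𝒯_p^{(α)}(t^α)`. -/

noncomputable section

theorem weylIntegral_comp_mul_left (γ : ℝ) (f : ℝ → ℂ) {u : ℝ} (hu : 0 < u) (t : ℝ) :
    weylIntegral γ (fun s => f (u * s)) t = ((u ^ (-γ) : ℝ) : ℂ) * weylIntegral γ f (u * t) := by
  have h := integral_comp_mul_left_Ioi
    (fun s => (((s - u * t) ^ (γ - 1) : ℝ) : ℂ) * f s) t hu
  have h2 : ∫ s in Ioi t, (((s - t) ^ (γ - 1) : ℝ) : ℂ) * f (u * s) =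
      ((u ^ (1 - γ) : ℝ) : ℂ) *
        ∫ s in Ioi t, (((u * s - u * t) ^ (γ - 1) : ℝ) : ℂ) * f (u * s) := by
    rw [← integral_const_mul]
    refine setIntegral_congr_fun measurableSet_Ioi fun s hs => ?_
    have hst : 0 ≤ s - t := sub_nonneg.2 (le_of_lt hs)
    change _ = _ * (_ * _)
    rw [← mul_assoc, ← Complex.ofReal_mul, ← mul_sub, Real.mul_rpow hu.le hst, ← mul_assoc,
      ← Real.rpow_add hu]
    simp
  rw [weylIntegral, weylIntegral, h2, h, Complex.real_smul, ← mul_assoc (Complex.ofReal (u ^ _)),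
    ← Complex.ofReal_mul, show u ^ (1 - γ) * u⁻¹ = u ^ (-γ) by
      rw [← Real.rpow_neg_one, ← Real.rpow_add hu]; ring_nf]
  ring

theorem iteratedDeriv_comp_mul_left (n : ℕ) (f : ℝ → ℂ) (u t : ℝ) :
    iteratedDeriv n (fun s => f (u * s)) t = ((u ^ n : ℝ) : ℂ) * iteratedDeriv n f (u * t) := by
  induction n generalizing t with
  | zero => simp
  | succ n ih =>
    rw [iteratedDeriv_succ, iteratedDeriv_succ, funext ih, deriv_const_mul_field,
      deriv_comp_mul_left, Complex.real_smul]
    push_cast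
    ring

/-- Counting powers with `n = ⌊α⌋₊ + 1`: the fractional integral of order `n - α` gives `u^(α - n)`,
the `n` derivatives give `u^n`, and `u^α t^α = (u t)^α`. The identity needs no regularity of `f`,
since each scaling rule used also holds for the default values of integrals and derivatives. -/
theorem weightedWeyl_comp_mul_left (α : ℝ) (f : ℝ → ℂ) {u t : ℝ} (hu : 0 < u) (ht : 0 < t) :
    weightedWeyl α (fun s => f (u * s)) t = weightedWeyl α f (u * t) := by
  rw [weightedWeyl, weightedWeyl, weylDeriv, weylDeriv,
    funext (weylIntegral_comp_mul_left _ f hu), iteratedDeriv_const_mul_field,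
    iteratedDeriv_comp_mul_left, ← mul_assoc (Complex.ofReal (u ^ _)), ← Complex.ofReal_mul,
    ← Real.rpow_natCast, ← Real.rpow_add hu, Real.mul_rpow hu.le ht.le]
  push_cast
  ring_nf

variable {α : ℝ} {p : ℝ≥0∞} [Fact (1 ≤ p)]

namespace SobolevT

theorem pairing_eq {q : ℝ≥0∞} [Fact (1 ≤ q)] (hα : 0 ≤ α) (f : SobolevT α p) (g : SobolevT α q) :
    pairing f g = ∫ t, D f t * D g t ∂halfLine := by
  have hΓ : Real.Gamma (α + 1) ≠ 0 := (Real.Gamma_pos_of_pos (by linarith)).ne'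
  rw [pairing, ← integral_const_mul]
  refine setIntegral_congr_fun measurableSet_Ioi fun t (ht : 0 < t) => ?_
  have h : 1 / Real.Gamma (α + 1) ^ 2 * ((Real.Gamma (α + 1) * t ^ (-α)) *
      (Real.Gamma (α + 1) * t ^ (-α)) * t ^ (2 * α)) = 1 := by
    rw [show (2 : ℝ) * α = α + α by ring, Real.rpow_add ht, Real.rpow_neg ht.le]
    have := (Real.rpow_pos_of_pos ht α).ne'
    field_simp
  have h' := congrArg Complex.ofReal h
  push_cast at h'
  simp only [weyl]
  push_cast
  linear_combination ((D f : ℝ → ℂ) t * (D g : ℝ → ℂ) t) * h'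

end SobolevT

variable [hp : Fact (p ≠ ∞)] {k : ℝ → ℝ}

theorem dilLp_prodMap_mem_schwartzGraph {u : ℝ} (hu : 0 < u)
    {w : Lp ℂ p halfLine × Lp ℂ p halfLine} (hw : w ∈ schwartzGraph α p) :
    (dilLp p u).prodMap (dilLp p u) w ∈ schwartzGraph α p := by
  induction hw using Submodule.span_induction with
  | mem w hw =>
    obtain ⟨φ, h1, h2⟩ := hw
    refine Submodule.subset_span ⟨SchwartzMap.compCLMOfContinuousLinearEquiv ℂ
      (ContinuousLinearEquiv.smulLeft (Units.mk0 u hu.ne')) φ, ?_, ?_⟩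
    · filter_upwards [coeFn_dilLp hu w.1,
        (quasiMeasurePreserving_mul_left_halfLine hu).ae_eq_comp h1] with t ht1 ht2
      exact ht1.trans ht2
    · filter_upwards [coeFn_dilLp hu w.2, ae_halfLine_pos,
        (quasiMeasurePreserving_mul_left_halfLine hu).ae_eq_comp h2] with t ht1 ht ht2
      exact (ht1.trans ht2).trans (weightedWeyl_comp_mul_left α φ hu ht).symm
  | zero => rw [map_zero]; exact zero_mem _
  | add x y _ _ hx hy => rw [map_add]; exact Submodule.add_mem _ hx hy
  | smul c x _ hx => rw [map_smul]; exact Submodule.smul_mem _ c hx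

theorem dilLp_prodMap_mem_closure {u : ℝ} (hu : 0 < u)
    {w : Lp ℂ p halfLine × Lp ℂ p halfLine} (hw : w ∈ (schwartzGraph α p).topologicalClosure) :
    (dilLp p u).prodMap (dilLp p u) w ∈ (schwartzGraph α p).topologicalClosure :=
  map_mem_closure ((dilLp p u).prodMap (dilLp p u)).continuous hw
    fun _ => dilLp_prodMap_mem_schwartzGraph hu

/-- The quotient map by `X` is continuous and kills the integrand almost everywhere, hence kills the
integral. -/
theorem Submodule.integral_mem_of_isClosed {ι E : Type*} [MeasurableSpace ι] {μ : Measure ι}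
    [NormedAddCommGroup E] [NormedSpace ℂ E] [CompleteSpace E] (X : Submodule ℂ E)
    (hX : IsClosed (X : Set E)) {φ : ι → E} (hφ : Integrable φ μ) (h : ∀ᵐ a ∂μ, φ a ∈ X) :
    ∫ a, φ a ∂μ ∈ X := by
  -- Closedness makes the quotient seminorm a norm, so that the quotient is a normed space in which
  -- to integrate.
  have : IsClosed (X : Set E) := hX
  rw [← Submodule.Quotient.mk_eq_zero]
  change X.mkQL (∫ a, φ a ∂μ) = 0
  rw [← ContinuousLinearMap.integral_comp_comm _ hφ]
  refine integral_eq_zero_of_ae ?_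
  filter_upwards [h] with a ha
  exact (Submodule.Quotient.mk_eq_zero X).2 ha

theorem DilationWeight.averageLp_mem_closure (hk : DilationWeight p k)
    {w : Lp ℂ p halfLine × Lp ℂ p halfLine} (hw : w ∈ (schwartzGraph α p).topologicalClosure) :
    (hk.averageLp w.1, hk.averageLp w.2) ∈ (schwartzGraph α p).topologicalClosure := by
  rw [hk.averageLp_apply, hk.averageLp_apply,
    ← integral_pair (hk.integrable_smul_dilLp w.1) (hk.integrable_smul_dilLp w.2)]
  refine Submodule.integral_mem_of_isClosed _ (Submodule.isClosed_topologicalClosure _)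
    ((hk.integrable_smul_dilLp w.1).prodMk (hk.integrable_smul_dilLp w.2)) ?_
  filter_upwards [ae_halfLine_pos] with u hu
  exact Submodule.smul_mem _ (k u : ℂ) (dilLp_prodMap_mem_closure hu hw)

namespace SobolevT

variable (α) in
/-- The operator `f ↦ ∫ k u f (u ·) du` on `𝒯_p^{(α)}(t^α)`. -/
def average (hk : DilationWeight p k) : SobolevT α p →L[ℂ] SobolevT α p :=
  LinearMap.mkContinuous
    { toFun := fun f => ⟨(hk.averageLp (toLp f), hk.averageLp (D f)),
        hk.averageLp_mem_closure f.2⟩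
      map_add' := fun f g => Subtype.ext (Prod.ext (map_add hk.averageLp (toLp f) (toLp g))
        (map_add hk.averageLp (D f) (D g)))
      map_smul' := fun c f => Subtype.ext (Prod.ext (map_smul hk.averageLp c (toLp f))
        (map_smul hk.averageLp c (D f))) }
    (∫ u in Ioi 0, ‖k u * u ^ (-(1 / p.toReal))‖) fun f => hk.norm_averageLp_le (D f)

theorem D_average (hk : DilationWeight p k) (f : SobolevT α p) :
    D (average α hk f) = hk.averageLp (D f) := rfl

theorem norm_average_le (hk : DilationWeight p k) :
    ‖average α hk‖ ≤ ∫ u in Ioi 0, ‖k u * u ^ (-(1 / p.toReal))‖ :=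
  LinearMap.mkContinuous_norm_le _ (by positivity) _

end SobolevT

end

/-! ### The two Cesàro weights and their beta integrals. -/

noncomputable section

theorem integrableOn_Ioo_rpow_mul_rpow {a b : ℝ} (ha : 0 < a) (hb : 0 < b) :
    IntegrableOn (fun x => x ^ (a - 1) * (1 - x) ^ (b - 1)) (Ioo (0 : ℝ) 1) ∧
      ∫ x in Ioo (0 : ℝ) 1, x ^ (a - 1) * (1 - x) ^ (b - 1) =
        Real.Gamma a * Real.Gamma b / Real.Gamma (a + b) := by
  have hcast : ∀ x ∈ Ioo (0 : ℝ) 1, (x : ℂ) ^ ((a : ℂ) - 1) * (1 - (x : ℂ)) ^ ((b : ℂ) - 1) =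
      ((x ^ (a - 1) * (1 - x) ^ (b - 1) : ℝ) : ℂ) := fun x hx => by
    rw [Complex.ofReal_mul, Complex.ofReal_cpow hx.1.le, Complex.ofReal_cpow (by linarith [hx.2])]
    push_cast
    rfl
  have h1 := Complex.betaIntegral_convergent (u := a) (v := b) (by simpa) (by simpa)
  rw [intervalIntegrable_iff_integrableOn_Ioo_of_le zero_le_one,
    integrableOn_congr_fun hcast measurableSet_Ioo] at h1
  refine ⟨by simpa [IntegrableOn] using h1.re, ?_⟩
  have h2 := ProbabilityTheory.beta_eq_betaIntegralReal a b ha hb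
  rw [Complex.betaIntegral, intervalIntegral.integral_of_le zero_le_one,
    integral_Ioc_eq_integral_Ioo, setIntegral_congr_fun measurableSet_Ioo hcast,
    integral_complex_ofReal, Complex.ofReal_re] at h2
  exact h2.symm

theorem integral_Ioi_comp_inv {E : Type*} [NormedAddCommGroup E] [NormedSpace ℝ E] (g : ℝ → E) :
    ∫ u in Ioi (0 : ℝ), u ^ (-2 : ℝ) • g u⁻¹ = ∫ u in Ioi (0 : ℝ), g u := by
  rw [← integral_comp_rpow_Ioi g (neg_ne_zero.2 one_ne_zero)]
  simp only [abs_neg, abs_one, one_mul]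
  refine setIntegral_congr_fun measurableSet_Ioi fun u hu => ?_
  simp only [Real.rpow_neg_one]
  norm_num

theorem integrableOn_Ioi_comp_inv {E : Type*} [NormedAddCommGroup E] [NormedSpace ℝ E]
    (g : ℝ → E) : IntegrableOn (fun u => u ^ (-2 : ℝ) • g u⁻¹) (Ioi (0 : ℝ)) ↔
      IntegrableOn g (Ioi (0 : ℝ)) := by
  rw [← integrableOn_Ioi_comp_rpow_iff g (neg_ne_zero.2 one_ne_zero)]
  simp only [abs_neg, abs_one, one_mul]
  refine integrableOn_congr_fun (fun u hu => ?_) measurableSet_Ioi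
  simp only [Real.rpow_neg_one]
  norm_num

/-- The weight `β (1 - u)^(β - 1)` on `(0, 1)`, whose dilation average is `𝒞_β`. -/
def cesaroWeight (β : ℝ) : ℝ → ℝ := (Ioo 0 1).indicator fun u => β * (1 - u) ^ (β - 1)

/-- The weight `β (u - 1)^(β - 1) u^(-β)` on `(1, ∞)`, whose dilation average is `𝒞_β^*`. -/
def dualCesaroWeight (β : ℝ) : ℝ → ℝ :=
  (Ioi 1).indicator fun u => β * ((u - 1) ^ (β - 1) / u ^ β)

theorem measurable_cesaroWeight (β : ℝ) : Measurable (cesaroWeight β) :=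
  Measurable.indicator (by fun_prop) measurableSet_Ioo

theorem measurable_dualCesaroWeight (β : ℝ) : Measurable (dualCesaroWeight β) :=
  Measurable.indicator (by fun_prop) measurableSet_Ioi

theorem dualCesaroWeight_nonneg {β : ℝ} (hβ : 0 < β) (u : ℝ) : 0 ≤ dualCesaroWeight β u :=
  indicator_nonneg (fun u (hu : 1 < u) => mul_nonneg hβ.le
    (div_nonneg (Real.rpow_nonneg (by linarith) _) (Real.rpow_nonneg (by linarith) _))) u

/-- The symmetry behind the duality; it also reduces the moments of the dual weight to those of
`cesaroWeight`. -/
theorem dualCesaroWeight_inv (β : ℝ) {u : ℝ} (hu : 0 < u) :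
    dualCesaroWeight β u⁻¹ = u * cesaroWeight β u := by
  by_cases h : u < 1
  · rw [dualCesaroWeight, cesaroWeight, indicator_of_mem (show u⁻¹ ∈ Ioi 1 from (one_lt_inv₀ hu).2 h),
      indicator_of_mem (show u ∈ Ioo 0 1 from ⟨hu, h⟩),
      show u⁻¹ - 1 = (1 - u) / u by field_simp, Real.div_rpow (by linarith) hu.le,
      Real.inv_rpow hu.le, Real.rpow_sub_one hu.ne' β]
    have := (Real.rpow_pos_of_pos hu β).ne'
    field_simp
  · rw [dualCesaroWeight, cesaroWeight, indicator_of_notMem, indicator_of_notMem, mul_zero]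
    · exact fun h' => h h'.2
    · exact fun h' => h ((one_lt_inv₀ hu).1 h')

theorem integral_cesaroWeight {β a : ℝ} (hβ : 0 < β) (ha : 0 < a) :
    IntegrableOn (fun u => cesaroWeight β u * u ^ (a - 1)) (Ioi 0) ∧
      ∫ u in Ioi 0, cesaroWeight β u * u ^ (a - 1) =
        Real.Gamma (β + 1) * Real.Gamma a / Real.Gamma (β + a) := by
  obtain ⟨h1, h2⟩ := integrableOn_Ioo_rpow_mul_rpow ha hβ
  have h : (fun u => cesaroWeight β u * u ^ (a - 1)) =
      (Ioo 0 1).indicator fun u => β * (u ^ (a - 1) * (1 - u) ^ (β - 1)) := by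
    ext u
    by_cases hu : u ∈ Ioo (0 : ℝ) 1
    · simp only [cesaroWeight, indicator_of_mem hu]; ring
    · simp only [cesaroWeight, indicator_of_notMem hu, zero_mul]
  have hsub : Ioi (0 : ℝ) ∩ Ioo 0 1 = Ioo 0 1 := inter_eq_right.2 fun u hu => hu.1
  rw [h]
  refine ⟨((integrable_indicator_iff measurableSet_Ioo).2 (h1.const_mul β)).integrableOn, ?_⟩
  rw [setIntegral_indicator measurableSet_Ioo, hsub, integral_const_mul, h2,
    Real.Gamma_add_one hβ.ne', add_comm a]
  ring

theorem rpow_neg_two_smul_dualCesaroWeight_inv (β a : ℝ) {u : ℝ} (hu : 0 < u) :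
    u ^ (-2 : ℝ) • (dualCesaroWeight β u⁻¹ * u⁻¹ ^ (-a)) = cesaroWeight β u * u ^ (a - 1) := by
  rw [dualCesaroWeight_inv β hu, Real.inv_rpow hu.le, Real.rpow_neg hu.le a, inv_inv,
    Real.rpow_sub_one hu.ne', Real.rpow_neg hu.le, Real.rpow_two, smul_eq_mul]
  field_simp

theorem integral_dualCesaroWeight {β a : ℝ} (hβ : 0 < β) (ha : 0 < a) :
    IntegrableOn (fun u => dualCesaroWeight β u * u ^ (-a)) (Ioi 0) ∧
      ∫ u in Ioi 0, dualCesaroWeight β u * u ^ (-a) =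
        Real.Gamma (β + 1) * Real.Gamma a / Real.Gamma (β + a) := by
  obtain ⟨h1, h2⟩ := integral_cesaroWeight hβ ha
  have h : EqOn (fun u => u ^ (-2 : ℝ) • (dualCesaroWeight β u⁻¹ * u⁻¹ ^ (-a)))
      (fun u => cesaroWeight β u * u ^ (a - 1)) (Ioi 0) :=
    fun u hu => rpow_neg_two_smul_dualCesaroWeight_inv β a hu
  rw [← integrableOn_Ioi_comp_inv, ← integral_Ioi_comp_inv,
    integrableOn_congr_fun h measurableSet_Ioi, setIntegral_congr_fun measurableSet_Ioi h]
  exact ⟨h1, h2⟩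

variable {α β : ℝ} {p : ℝ≥0∞}

theorem dilationWeight_cesaroWeight (hβ : 0 < β) (hp : 1 < p) :
    DilationWeight p (cesaroWeight β) := by
  refine ⟨measurable_cesaroWeight β, ?_⟩
  -- The beta integral is taken at `a = 1 - 1/p`, so that `a - 1 = -1/p`; positivity of `a` is where
  -- `p > 1` enters.
  have h : (0 : ℝ) < 1 - 1 / p.toReal := by
    rcases eq_or_ne p ∞ with rfl | hp'
    · simp
    · have : 1 < p.toReal := by simpa using (ENNReal.toReal_lt_toReal ENNReal.one_ne_top hp').2 hp
      rw [sub_pos, div_lt_one (by linarith)]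
      exact this
  simpa using (integral_cesaroWeight hβ h).1

theorem dilationWeight_dualCesaroWeight (hβ : 0 < β) (hp : 0 < p.toReal) :
    DilationWeight p (dualCesaroWeight β) :=
  ⟨measurable_dualCesaroWeight β, (integral_dualCesaroWeight hβ (one_div_pos.2 hp)).1⟩

theorem integral_norm_dualCesaroWeight (hβ : 0 < β) (hp : 0 < p.toReal) :
    ∫ u in Ioi 0, ‖dualCesaroWeight β u * u ^ (-(1 / p.toReal))‖ =
      Real.Gamma (β + 1) * Real.Gamma (1 / p.toReal) / Real.Gamma (β + 1 / p.toReal) := by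
  rw [← (integral_dualCesaroWeight hβ (one_div_pos.2 hp)).2]
  refine setIntegral_congr_fun measurableSet_Ioi fun u (hu : 0 < u) => ?_
  exact Real.norm_of_nonneg
    (mul_nonneg (dualCesaroWeight_nonneg hβ u) (Real.rpow_nonneg hu.le _))

end

/-! ### Changes of variable from averages to the integrals of the theorem. -/

noncomputable section

variable {β t : ℝ} {f : ℝ → ℂ}

theorem cesaro_integral_eq (β : ℝ) (f : ℝ → ℂ) (ht : 0 < t)
    (h : IntegrableOn (fun u => (cesaroWeight β u : ℂ) * f (u * t)) (Ioi 0)) (hβ : 0 < β) :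
    IntegrableOn (fun s => (((t - s) ^ (β - 1) : ℝ) : ℂ) * f s) (Ioo 0 t) ∧
      ∫ u in Ioi 0, (cesaroWeight β u : ℂ) * f (u * t) =
        ((β / t ^ β : ℝ) : ℂ) * ∫ s in Ioo 0 t, (((t - s) ^ (β - 1) : ℝ) : ℂ) * f s := by
  set G : ℝ → ℂ := (Ioo 0 t).indicator fun s => (((t - s) ^ (β - 1) : ℝ) : ℂ) * f s with hG
  -- The constant carries `t^(β - 1)` rather than `t^β`; the Jacobian of `s = t u` supplies the
  -- remaining `1/t`.
  have hGt : ∀ u, (cesaroWeight β u : ℂ) * f (u * t) =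
      ((β / t ^ (β - 1) : ℝ) : ℂ) * G (t * u) := fun u => by
    by_cases hu : u ∈ Ioo (0 : ℝ) 1
    · have hut : t * u ∈ Ioo 0 t := ⟨mul_pos ht hu.1, by nlinarith [hu.2]⟩
      rw [hG, cesaroWeight, indicator_of_mem hu, indicator_of_mem hut, mul_comm u,
        ← mul_assoc (Complex.ofReal _) (Complex.ofReal _), ← Complex.ofReal_mul,
        show t - t * u = t * (1 - u) by ring, Real.mul_rpow ht.le (by linarith [hu.2])]
      have := (Real.rpow_pos_of_pos ht (β - 1)).ne'
      congr 2
      field_simp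
    · have hut : t * u ∉ Ioo 0 t := fun hut =>
        hu ⟨pos_of_mul_pos_right hut.1 ht.le, by nlinarith [hut.2]⟩
      rw [hG, cesaroWeight, indicator_of_notMem hu, indicator_of_notMem hut]
      simp
  have hsub : Ioi (0 : ℝ) ∩ Ioo 0 t = Ioo 0 t := inter_eq_right.2 fun u hu => hu.1
  have hc : ((β / t ^ (β - 1) : ℝ) : ℂ) ≠ 0 :=
    Complex.ofReal_ne_zero.2 (div_pos hβ (Real.rpow_pos_of_pos ht _)).ne'
  simp_rw [hGt] at h ⊢
  constructor
  · have h2 : IntegrableOn (fun u => G (t * u)) (Ioi 0) := by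
      have := h.const_mul (((β / t ^ (β - 1) : ℝ) : ℂ)⁻¹)
      simp_rw [← mul_assoc, inv_mul_cancel₀ hc, one_mul] at this
      exact this
    rw [integrableOn_Ioi_comp_mul_left_iff _ _ ht, mul_zero, hG] at h2
    have h3 := h2.mono_set (t := Ioi 0) (s := Ioo 0 t) fun _ hs => hs.1
    exact (integrableOn_congr_fun (fun s hs => by rw [indicator_of_mem hs]) measurableSet_Ioo).1 h3
  · rw [integral_const_mul, integral_comp_mul_left_Ioi G 0 ht, mul_zero, hG,
      setIntegral_indicator measurableSet_Ioo, hsub, Complex.real_smul, ← mul_assoc,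
      ← Complex.ofReal_mul, Real.rpow_sub_one ht.ne']
    congr 2
    field_simp

theorem dualCesaro_integral_eq (β : ℝ) (f : ℝ → ℂ) (ht : 0 < t)
    (h : IntegrableOn (fun u => (dualCesaroWeight β u : ℂ) * f (u * t)) (Ioi 0)) (hβ : 0 < β) :
    IntegrableOn (fun s => (((s - t) ^ (β - 1) / s ^ β : ℝ) : ℂ) * f s) (Ioi t) ∧
      ∫ u in Ioi 0, (dualCesaroWeight β u : ℂ) * f (u * t) =
        (β : ℂ) * ∫ s in Ioi t, (((s - t) ^ (β - 1) / s ^ β : ℝ) : ℂ) * f s := by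
  set G : ℝ → ℂ := (Ioi t).indicator fun s => (((s - t) ^ (β - 1) / s ^ β : ℝ) : ℂ) * f s with hG
  -- The kernel is homogeneous of degree `-1`, hence the factor `t`, which the Jacobian cancels.
  have hGt : ∀ u, (dualCesaroWeight β u : ℂ) * f (u * t) =
      ((β * t : ℝ) : ℂ) * G (t * u) := fun u => by
    by_cases hu : u ∈ Ioi (1 : ℝ)
    · have hu' : 1 < u := hu
      have hut : t * u ∈ Ioi t := by rw [mem_Ioi]; nlinarith
      rw [hG, dualCesaroWeight, indicator_of_mem hu, indicator_of_mem hut, mul_comm u,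
        ← mul_assoc (Complex.ofReal _) (Complex.ofReal _), ← Complex.ofReal_mul,
        show t * u - t = t * (u - 1) by ring, Real.mul_rpow ht.le (by linarith),
        Real.mul_rpow ht.le (by linarith), Real.rpow_sub_one ht.ne']
      have := (Real.rpow_pos_of_pos ht β).ne'
      congr 2
      field_simp
    · have hut : t * u ∉ Ioi t := fun hut => hu (by rw [mem_Ioi] at hut ⊢; nlinarith)
      rw [hG, dualCesaroWeight, indicator_of_notMem hu, indicator_of_notMem hut]
      simp
  have hsub : Ioi (0 : ℝ) ∩ Ioi t = Ioi t := inter_eq_right.2 (Ioi_subset_Ioi ht.le)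
  have hc : ((β * t : ℝ) : ℂ) ≠ 0 := Complex.ofReal_ne_zero.2 (mul_pos hβ ht).ne'
  simp_rw [hGt] at h ⊢
  constructor
  · have h2 : IntegrableOn (fun u => G (t * u)) (Ioi 0) := by
      have := h.const_mul (((β * t : ℝ) : ℂ)⁻¹)
      simp_rw [← mul_assoc, inv_mul_cancel₀ hc, one_mul] at this
      exact this
    rw [integrableOn_Ioi_comp_mul_left_iff _ _ ht, mul_zero, hG] at h2
    have h3 := h2.mono_set (Ioi_subset_Ioi ht.le)
    exact (integrableOn_congr_fun (fun s hs => by rw [indicator_of_mem hs]) measurableSet_Ioi).1 h3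
  · rw [integral_const_mul, integral_comp_mul_left_Ioi G 0 ht, mul_zero, hG,
      setIntegral_indicator measurableSet_Ioi, hsub, Complex.real_smul, ← mul_assoc,
      ← Complex.ofReal_mul]
    congr 2
    field_simp

theorem image_exp_neg_Iio : (fun r => Real.exp (-r)) '' Iio 0 = Ioi 1 := by
  ext v
  constructor
  · rintro ⟨r, hr, rfl⟩
    exact Real.one_lt_exp_iff.2 (neg_pos.2 hr)
  · intro hv
    have hv' : (1 : ℝ) < v := hv
    exact ⟨-Real.log v, neg_neg_iff_pos.2 (Real.log_pos hv'),
      by simp [Real.exp_log (zero_lt_one.trans hv')]⟩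

theorem dualCesaro_dilation_integral_eq (p : ℝ) (f : ℝ → ℂ) (hβ : 0 < β)
    (h : IntegrableOn (fun u => (dualCesaroWeight β u : ℂ) * f (u * t)) (Ioi 0)) :
    IntegrableOn (fun r => (((Real.exp (-r) - 1) ^ (β - 1) *
        Real.exp (-r * (1 - 1 / p - β)) : ℝ) : ℂ) * dilation p r f t) (Iic 0) ∧
      ∫ u in Ioi 0, (dualCesaroWeight β u : ℂ) * f (u * t) =
        (β : ℂ) * ∫ r in Iic (0 : ℝ), (((Real.exp (-r) - 1) ^ (β - 1) *
          Real.exp (-r * (1 - 1 / p - β)) : ℝ) : ℂ) * dilation p r f t := by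
  set G : ℝ → ℂ := fun u => (((u - 1) ^ (β - 1) / u ^ β : ℝ) : ℂ) * f (u * t) with hG
  have hGi : ∀ u, (dualCesaroWeight β u : ℂ) * f (u * t) =
      (Ioi 1).indicator (fun u => (β : ℂ) * G u) u := fun u => by
    by_cases hu : u ∈ Ioi (1 : ℝ)
    · rw [dualCesaroWeight, indicator_of_mem hu, indicator_of_mem hu, hG]
      push_cast
      ring
    · rw [dualCesaroWeight, indicator_of_notMem hu, indicator_of_notMem hu]
      simp
  have hsub : Ioi (0 : ℝ) ∩ Ioi 1 = Ioi 1 := inter_eq_right.2 (Ioi_subset_Ioi zero_le_one)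
  have hd : ∀ r ∈ Iio (0 : ℝ), HasDerivWithinAt (fun r => Real.exp (-r)) (-Real.exp (-r)) (Iio 0) r :=
    fun r _ => by simpa using! ((hasDerivAt_neg r).exp).hasDerivWithinAt
  have hinj : InjOn (fun r => Real.exp (-r)) (Iio 0) :=
    fun a _ b _ hab => neg_injective (Real.exp_injective hab)
  -- With `u = e^(-r)` the Jacobian gives `e^(-r)` and `u^(-β)` gives `e^(rβ)`; the `-1/p` in the
  -- exponent compensates the factor `e^(-r/p)` of `dilation`.
  have hr : EqOn (fun r => |-Real.exp (-r)| • G (Real.exp (-r)))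
      (fun r => (((Real.exp (-r) - 1) ^ (β - 1) *
        Real.exp (-r * (1 - 1 / p - β)) : ℝ) : ℂ) * dilation p r f t) (Iio 0) := fun r _ => by
    change |-Real.exp (-r)| • G (Real.exp (-r)) = _ * (_ * _)
    rw [abs_neg, abs_of_pos (Real.exp_pos _), hG, Complex.real_smul, ← mul_assoc, ← mul_assoc,
      ← Complex.ofReal_mul, ← Complex.ofReal_mul, mul_assoc (_ ^ _), ← Real.exp_add,
      ← Real.exp_mul, div_eq_mul_inv, ← Real.exp_neg, mul_left_comm, ← Real.exp_add]
    ring_nf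
  simp_rw [hGi] at h ⊢
  rw [IntegrableOn, integrable_indicator_iff measurableSet_Ioi, IntegrableOn,
    Measure.restrict_restrict measurableSet_Ioi, inter_comm, hsub] at h
  have h1 : IntegrableOn G (Ioi 1) := by
    have := h.const_mul ((β : ℂ)⁻¹)
    simp_rw [← mul_assoc, inv_mul_cancel₀ (Complex.ofReal_ne_zero.2 hβ.ne'), one_mul] at this
    exact this
  rw [setIntegral_indicator measurableSet_Ioi, hsub, integral_const_mul,
    integrableOn_Iic_iff_integrableOn_Iio, integral_Iic_eq_integral_Iio]
  rw [← image_exp_neg_Iio] at h1 ⊢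
  rw [integrableOn_image_iff_integrableOn_abs_deriv_smul measurableSet_Iio hd hinj,
    integrableOn_congr_fun hr measurableSet_Iio] at h1
  rw [integral_image_eq_integral_abs_deriv_smul measurableSet_Iio hd hinj,
    setIntegral_congr_fun measurableSet_Iio hr]
  exact ⟨h1, rfl⟩

end

/-! ### The exponential as an explicit element of `𝒯_p^{(α)}(t^α)`. -/

noncomputable section

/-- Translation by `t` leaves Euler's integral for `Γ(γ)`: the exponential is fixed by every Weyl
integral. This gives a function whose `D₊^α` is explicit and positive for every `α ≥ 0`. -/
theorem weylIntegral_exp_neg {γ : ℝ} (hγ : 0 < γ) {f : ℝ → ℂ}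
    (hf : ∀ t, 0 < t → f t = (Real.exp (-t) : ℂ)) {t : ℝ} (ht : 0 < t) :
    weylIntegral γ f t = (Real.exp (-t) : ℂ) := by
  have h1 : ∫ s in Ioi t, (((s - t) ^ (γ - 1) : ℝ) : ℂ) * f s =
      ((∫ s in Ioi t, (s - t) ^ (γ - 1) * Real.exp (-s) : ℝ) : ℂ) := by
    rw [← integral_complex_ofReal]
    refine setIntegral_congr_fun measurableSet_Ioi fun s (hs : t < s) => ?_
    simp only [hf s (ht.trans hs), Complex.ofReal_mul]
  have h2 : ∫ s in Ioi t, (s - t) ^ (γ - 1) * Real.exp (-s) = Real.exp (-t) * Real.Gamma γ := by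
    have h := (measurePreserving_add_right volume t).setIntegral_preimage_emb
      (measurableEmbedding_addRight t) (fun s => (s - t) ^ (γ - 1) * Real.exp (-s)) (Ioi t)
    rw [← h, Real.Gamma_eq_integral hγ, ← integral_const_mul, preimage_add_const_Ioi, sub_self]
    refine setIntegral_congr_fun measurableSet_Ioi fun s _ => ?_
    simp only [add_sub_cancel_right, neg_add, Real.exp_add]
    ring
  rw [weylIntegral, h1, h2, ← Complex.ofReal_mul]
  have := (Real.Gamma_pos_of_pos hγ).ne'
  congr 1
  field_simp

theorem iteratedDeriv_ofReal_exp_neg (n : ℕ) (t : ℝ) :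
    iteratedDeriv n (fun s : ℝ => (Real.exp (-s) : ℂ)) t = (-1) ^ n * (Real.exp (-t) : ℂ) := by
  induction n generalizing t with
  | zero => simp
  | succ n ih =>
    have h : HasDerivAt (fun s : ℝ => (Real.exp (-s) : ℂ)) ((-Real.exp (-t) : ℝ) : ℂ) t :=
      HasDerivAt.ofReal_comp (by simpa using (hasDerivAt_neg t).exp)
    rw [iteratedDeriv_succ, funext ih, deriv_const_mul_field, h.deriv]
    push_cast
    ring

theorem weightedWeyl_exp_neg {α : ℝ} {f : ℝ → ℂ}
    (hf : ∀ t, 0 < t → f t = (Real.exp (-t) : ℂ)) {t : ℝ} (ht : 0 < t) :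
    weightedWeyl α f t = ((t ^ α / Real.Gamma (α + 1) * Real.exp (-t) : ℝ) : ℂ) := by
  have hγ : 0 < ((⌊α⌋₊ + 1 : ℕ) : ℝ) - α := by
    push_cast; linarith [Nat.lt_floor_add_one α]
  have h : weylIntegral (((⌊α⌋₊ + 1 : ℕ) : ℝ) - α) f =ᶠ[nhds t]
      fun s => (Real.exp (-s) : ℂ) := by
    filter_upwards [lt_mem_nhds ht] with s hs
    exact weylIntegral_exp_neg hγ hf hs
  rw [weightedWeyl, weylDeriv, h.iteratedDeriv_eq, iteratedDeriv_ofReal_exp_neg,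
    ← mul_assoc (_ ^ _) (_ ^ _), ← mul_pow]
  simp

theorem exists_schwartzMap_eq_exp_neg :
    ∃ φ : 𝓢(ℝ, ℂ), ∀ t, 0 < t → φ t = (Real.exp (-t) : ℂ) := by
  set h : ℝ → ℂ := fun t => ((Real.smoothTransition (t + 1) * Real.exp (-t) : ℝ) : ℂ) with hh
  have hsmooth : ∀ n : ℕ∞, ContDiff ℝ n h := fun n =>
    Complex.ofRealCLM.contDiff.comp
      ((Real.smoothTransition.contDiff.comp (contDiff_id.add contDiff_const)).mul
        (Real.contDiff_exp.comp contDiff_neg))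
  have hpos : ∀ t, 0 < t → h t = (Real.exp (-t) : ℂ) := fun t ht => by
    rw [hh]
    simp only [Real.smoothTransition.one_of_one_le (show 1 ≤ t + 1 by linarith), one_mul]
  refine ⟨⟨h, hsmooth _, fun k n => ?_⟩, hpos⟩
  simp_rw [norm_iteratedFDeriv_eq_norm_iteratedDeriv]
  have hcont : Continuous fun x : ℝ => ‖x‖ ^ k * ‖iteratedDeriv n h x‖ :=
    (continuous_norm.pow k).mul ((hsmooth n).continuous_iteratedDeriv n le_rfl).norm
  obtain ⟨C, hC⟩ := (isCompact_Icc (a := (-1 : ℝ)) (b := 0)).exists_bound_of_continuousOn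
    hcont.continuousOn
  have hC0 : 0 ≤ C := (norm_nonneg _).trans (hC 0 (by simp))
  -- The function vanishes left of `-1`, is bounded by compactness on `[-1, 0]`, and on `(0, ∞)`
  -- satisfies `x^k e^(-x) ≤ k!`.
  refine ⟨max C k.factorial, fun x => ?_⟩
  rcases lt_or_ge x (-1) with hx | hx
  · have : h =ᶠ[nhds x] fun _ => 0 := by
      filter_upwards [gt_mem_nhds hx] with y hy
      rw [hh]
      simp [Real.smoothTransition.zero_of_nonpos (show y + 1 ≤ 0 by linarith)]
    rw [this.iteratedDeriv_eq, iteratedDeriv_const]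
    simp [hC0]
  rcases le_or_gt x 0 with hx0 | hx0
  · exact (le_abs_self _).trans ((hC x ⟨hx, hx0⟩).trans (le_max_left _ _))
  · have : h =ᶠ[nhds x] fun s => (Real.exp (-s) : ℂ) := by
      filter_upwards [lt_mem_nhds hx0] with y hy using hpos y hy
    rw [this.iteratedDeriv_eq, iteratedDeriv_ofReal_exp_neg]
    refine le_trans ?_ (le_max_right _ _)
    have hk := Real.pow_div_factorial_le_exp x hx0.le k
    rw [div_le_iff₀ (by positivity)] at hk
    rw [norm_mul, norm_pow, norm_neg, norm_one, one_pow, one_mul, Complex.norm_real,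
      Real.norm_of_nonneg hx0.le, Real.norm_of_nonneg (Real.exp_pos _).le, Real.exp_neg,
      ← div_eq_mul_inv, div_le_iff₀ (Real.exp_pos _), mul_comm]
    exact hk

theorem memLp_rpow_mul_exp_neg {α : ℝ} (hα : 0 ≤ α) (c : ℝ) {p : ℝ≥0∞} [Fact (1 ≤ p)]
    (hp : p ≠ ∞) :
    MemLp (fun t : ℝ => ((t ^ α / c * Real.exp (-t) : ℝ) : ℂ)) p halfLine := by
  have hp0 : p ≠ 0 := (zero_lt_one.trans_le Fact.out).ne'
  have hp' : 0 < p.toReal := ENNReal.toReal_pos hp0 hp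
  have hm : Measurable fun t : ℝ => ((t ^ α / c * Real.exp (-t) : ℝ) : ℂ) := by fun_prop
  rw [← integrable_norm_rpow_iff hm.aestronglyMeasurable hp0 hp]
  have h := (integrableOn_rpow_mul_exp_neg_mul_rpow (s := α * p.toReal) (p := 1) (b := p.toReal)
    (by nlinarith [mul_nonneg hα hp'.le]) one_pos hp').const_mul (‖c‖⁻¹ ^ p.toReal)
  refine (integrableOn_congr_fun (fun t (ht : 0 < t) => ?_) measurableSet_Ioi).1 h
  have ht' := Real.rpow_pos_of_pos ht α
  simp only [Complex.norm_real, norm_mul, norm_div, Real.norm_of_nonneg ht'.le, Real.rpow_one,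
    Real.norm_of_nonneg (Real.exp_pos (-t)).le]
  rw [Real.mul_rpow (by positivity) (by positivity), div_eq_mul_inv,
    Real.mul_rpow ht'.le (by positivity), ← Real.rpow_mul ht.le, ← Real.exp_mul]
  ring_nf

theorem exists_D_ae_eq_rpow_mul_exp_neg {α : ℝ} (hα : 0 ≤ α) {p : ℝ≥0∞} [Fact (1 ≤ p)]
    (hp : p ≠ ∞) : ∃ f : SobolevT α p, SobolevT.D f =ᵐ[halfLine]
      fun t => ((t ^ α / Real.Gamma (α + 1) * Real.exp (-t) : ℝ) : ℂ) := by
  obtain ⟨φ, hφ⟩ := exists_schwartzMap_eq_exp_neg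
  have h1 : MemLp φ p halfLine := (φ.memLp p volume).restrict _
  have h2 := memLp_rpow_mul_exp_neg hα (Real.Gamma (α + 1)) hp
  refine ⟨⟨(h1.toLp _, h2.toLp _), subset_closure (Submodule.subset_span
    ⟨φ, h1.coeFn_toLp, h2.coeFn_toLp.trans ?_⟩)⟩, h2.coeFn_toLp⟩
  filter_upwards [ae_halfLine_pos] with t ht
  exact (weightedWeyl_exp_neg hφ ht).symm

/-! ### Duality of dilation averages. -/

variable {p q : ℝ≥0∞} [Fact (1 ≤ p)] [Fact (1 ≤ q)] [Fact (p ≠ ∞)] [Fact (q ≠ ∞)]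

theorem integral_dilLp_mul (f : Lp ℂ p halfLine) (g : Lp ℂ q halfLine) {u : ℝ} (hu : 0 < u) :
    ∫ t, dilLp p u f t * g t ∂halfLine = u⁻¹ • ∫ t, f t * dilLp q u⁻¹ g t ∂halfLine := by
  have h := integral_comp_mul_left_Ioi (fun t => f t * g (u⁻¹ * t)) 0 hu
  rw [mul_zero] at h
  calc ∫ t, dilLp p u f t * g t ∂halfLine
      = ∫ t in Ioi 0, f (u * t) * g (u⁻¹ * (u * t)) := by
        refine integral_congr_ae ?_
        filter_upwards [coeFn_dilLp hu f] with t ht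
        rw [ht, inv_mul_cancel_left₀ hu.ne']
    _ = _ := by
        rw [h]
        congr 1
        refine integral_congr_ae ?_
        filter_upwards [coeFn_dilLp (inv_pos.2 hu) g] with t ht
        rw [ht]

/-- The bounded pairing of `L^p` and `L^q` passes inside both Bochner integrals, so only adjoints of
single dilations are needed: the adjoint of the dilation by `u` is `u⁻¹` times the dilation by
`u⁻¹`. -/
theorem integral_averageLp_mul [p.HolderConjugate q] {k l : ℝ → ℝ} (hk : DilationWeight p k)
    (hl : DilationWeight q l) (hkl : ∀ u, 0 < u → l u⁻¹ = u * k u)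
    (f : Lp ℂ p halfLine) (g : Lp ℂ q halfLine) :
    ∫ t, hk.averageLp f t * g t ∂halfLine = ∫ t, f t * hl.averageLp g t ∂halfLine := by
  set B := (ContinuousLinearMap.mul ℂ ℂ).lpPairing halfLine p q with hB
  have hBeq : ∀ (f : Lp ℂ p halfLine) (g : Lp ℂ q halfLine),
      B f g = ∫ t, f t * g t ∂halfLine := fun f g => by
    rw [hB, ContinuousLinearMap.lpPairing_eq_integral]
    rfl
  rw [← hBeq, ← hBeq]
  change B.flip g (hk.averageLp f) = B f (hl.averageLp g)
  rw [hk.averageLp_apply, hl.averageLp_apply,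
    ← ContinuousLinearMap.integral_comp_comm _ (hk.integrable_smul_dilLp f),
    ← ContinuousLinearMap.integral_comp_comm _ (hl.integrable_smul_dilLp g)]
  -- After `u ↦ 1/u` on the right, the weight becomes `u^(-2) l(u⁻¹) = u⁻¹ k(u)`, and `u⁻¹` is the
  -- Jacobian of the dilation on the left.
  refine Eq.trans ?_ (integral_Ioi_comp_inv _)
  refine setIntegral_congr_fun measurableSet_Ioi fun u (hu : 0 < u) => ?_
  simp only [map_smul, ContinuousLinearMap.flip_apply]
  rw [hBeq, hBeq, integral_dilLp_mul f g hu, hkl u hu]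
  simp only [Complex.real_smul, smul_eq_mul, ← mul_assoc, ← Complex.ofReal_mul]
  congr 2
  rw [Real.rpow_neg hu.le, Real.rpow_two]
  field_simp

end

/-! ### The lower bound for the norm of the dual Cesàro operator. -/

noncomputable section

/-- The truncated power `u^c` on `(0, 1)`. -/
def powerWeight (c : ℝ) : ℝ → ℝ := (Ioo 0 1).indicator fun u => u ^ c

theorem powerWeight_nonneg (c u : ℝ) : 0 ≤ powerWeight c u :=
  indicator_nonneg (fun _ hu => Real.rpow_nonneg hu.1.le _) u

/-- Equality holds on `(0, 1)` by homogeneity; stretching by `v ≥ 1` only enlarges the support of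
the truncated power. -/
theorem powerWeight_le_powerWeight_inv_mul (c : ℝ) {u v : ℝ} (hv : 1 ≤ v) :
    v ^ (-c) * powerWeight c u ≤ powerWeight c (v⁻¹ * u) := by
  have hv0 : 0 < v := zero_lt_one.trans_le hv
  by_cases hu : u ∈ Ioo (0 : ℝ) 1
  · have hvu : v⁻¹ * u ∈ Ioo (0 : ℝ) 1 :=
      ⟨mul_pos (inv_pos.2 hv0) hu.1, by
        rw [inv_mul_lt_iff₀ hv0, mul_one]; exact hu.2.trans_le hv⟩
    rw [powerWeight, indicator_of_mem hu, indicator_of_mem hvu,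
      Real.mul_rpow (inv_pos.2 hv0).le hu.1.le, Real.inv_rpow hv0.le, Real.rpow_neg hv0.le]
  · rw [powerWeight, indicator_of_notMem hu, mul_zero]
    exact powerWeight_nonneg c _

/-- The average of `F` against the truncated power decays at most like `t^(-1 - c)`. -/
theorem rpow_mul_integral_powerWeight_le {c t v : ℝ} {F : ℝ → ℝ} (hF : ∀ t, 0 < t → 0 < F t)
    (ht : 0 < t) (hv : 1 ≤ v)
    (h1 : IntegrableOn (fun u => powerWeight c u * F (u * t)) (Ioi 0))
    (h2 : IntegrableOn (fun u => powerWeight c u * F (u * (v * t))) (Ioi 0)) :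
    v ^ (-1 - c) * ∫ u in Ioi 0, powerWeight c u * F (u * t) ≤
      ∫ u in Ioi 0, powerWeight c u * F (u * (v * t)) := by
  have hv0 : 0 < v := zero_lt_one.trans_le hv
  have heq : ∀ u, powerWeight c u * F (u * (v * t)) =
      powerWeight c (v⁻¹ * (v * u)) * F ((v * u) * t) := fun u => by
    rw [inv_mul_cancel_left₀ hv0.ne']; congr 2; ring
  simp_rw [heq] at h2 ⊢
  rw [integrableOn_Ioi_comp_mul_left_iff (fun u => powerWeight c (v⁻¹ * u) * F (u * t)) _ hv0,
    mul_zero] at h2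
  rw [integral_comp_mul_left_Ioi (fun u => powerWeight c (v⁻¹ * u) * F (u * t)) _ hv0, mul_zero,
    sub_eq_add_neg, Real.rpow_add hv0, Real.rpow_neg_one, mul_assoc, smul_eq_mul,
    ← integral_const_mul (v ^ (-c))]
  refine mul_le_mul_of_nonneg_left (setIntegral_mono_on (h1.const_mul _) h2 measurableSet_Ioi
    fun u (hu : 0 < u) => ?_) (inv_pos.2 hv0).le
  rw [← mul_assoc]
  exact mul_le_mul_of_nonneg_right (powerWeight_le_powerWeight_inv_mul c hv)
    (hF _ (mul_pos hu ht)).le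

theorem integral_powerWeight_pos {c t : ℝ} {F : ℝ → ℝ} (hF : ∀ t, 0 < t → 0 < F t) (ht : 0 < t)
    (h1 : IntegrableOn (fun u => powerWeight c u * F (u * t)) (Ioi 0)) :
    0 < ∫ u in Ioi 0, powerWeight c u * F (u * t) := by
  refine (setIntegral_pos_iff_support_of_nonneg_ae ?_ h1).2 ?_
  · filter_upwards [ae_halfLine_pos] with u hu
    exact mul_nonneg (powerWeight_nonneg c u) (hF _ (mul_pos hu ht)).le
  · refine lt_of_lt_of_le (by simp : 0 < volume (Ioo (0 : ℝ) 1)) (measure_mono fun u hu => ?_)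
    refine ⟨?_, hu.1⟩
    rw [Function.mem_support, powerWeight, indicator_of_mem hu]
    exact (mul_pos (Real.rpow_pos_of_pos hu.1 c) (hF _ (mul_pos hu.1 ht))).ne'

variable {α β : ℝ} {p : ℝ≥0∞}

theorem dilationWeight_powerWeight {ε : ℝ} (hε : 0 < ε) :
    DilationWeight p (powerWeight (1 / p.toReal + ε - 1)) := by
  refine ⟨Measurable.indicator (by fun_prop) measurableSet_Ioo, ?_⟩
  have h := (integrableOn_Ioo_rpow_mul_rpow hε one_pos).1
  have heq : (fun u => powerWeight (1 / p.toReal + ε - 1) u * u ^ (-(1 / p.toReal))) =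
      (Ioo 0 1).indicator fun u => u ^ (ε - 1) * (1 - u) ^ ((1 : ℝ) - 1) := by
    ext u
    by_cases hu : u ∈ Ioo (0 : ℝ) 1
    · simp only [powerWeight, indicator_of_mem hu]
      rw [← Real.rpow_add hu.1, sub_self, Real.rpow_zero, mul_one]
      congr 1
      ring
    · simp only [powerWeight, indicator_of_notMem hu, zero_mul]
  rw [heq]
  exact ((integrable_indicator_iff measurableSet_Ioo).2 h).integrableOn

variable [Fact (1 ≤ p)] [hp : Fact (p ≠ ∞)]

theorem toReal_pos_of_one_le : 0 < p.toReal :=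
  ENNReal.toReal_pos (zero_lt_one.trans_le Fact.out).ne' hp.out

/-- An approximate eigenfunction of the dual Cesàro operator, built from a positive function. -/
theorem mul_norm_powerWeight_average_le (hβ : 0 < β) {a : ℝ} (ha : 0 < a) {F : ℝ → ℝ}
    (hF : ∀ t, 0 < t → 0 < F t) {f : Lp ℂ p halfLine} (hf : f =ᵐ[halfLine] fun t => (F t : ℂ))
    (hk : DilationWeight p (dualCesaroWeight β))
    (hw : DilationWeight p (powerWeight (a - 1))) :
    hw.averageLp f ≠ 0 ∧
      Real.Gamma (β + 1) * Real.Gamma a / Real.Gamma (β + a) * ‖hw.averageLp f‖ ≤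
        ‖hk.averageLp (hw.averageLp f)‖ := by
  obtain ⟨hκi, hκ⟩ := integral_dualCesaroWeight hβ ha
  set κ := Real.Gamma (β + 1) * Real.Gamma a / Real.Gamma (β + a) with hκ'
  have hκ0 : 0 < κ := div_pos (mul_pos (Real.Gamma_pos_of_pos (by linarith))
    (Real.Gamma_pos_of_pos ha)) (Real.Gamma_pos_of_pos (by linarith))
  set J : ℝ → ℝ := fun t => ∫ u in Ioi 0, powerWeight (a - 1) u * F (u * t) with hJ
  have hmul : ∀ t, 0 < t → Measure.QuasiMeasurePreserving (fun u => u * t) halfLine halfLine :=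
    fun t ht => by simpa only [mul_comm] using quasiMeasurePreserving_mul_left_halfLine ht
  -- `f` may be replaced by `F` inside the averages
  have hint : ∀ᵐ t ∂halfLine,
      IntegrableOn (fun u => powerWeight (a - 1) u * F (u * t)) (Ioi 0) := by
    filter_upwards [hw.ae_integrableOn f, ae_halfLine_pos] with t ht ht0
    have h : IntegrableOn (fun u => ((powerWeight (a - 1) u * F (u * t) : ℝ) : ℂ)) (Ioi 0) := by
      refine ht.congr ?_
      filter_upwards [(hmul t ht0).ae_eq_comp hf] with u hu
      rw [Complex.ofReal_mul]
      exact congrArg _ hu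
    exact h.re
  have hJeq : hw.averageLp f =ᵐ[halfLine] fun t => (J t : ℂ) := by
    filter_upwards [hw.averageLp_ae_eq f, ae_halfLine_pos] with t ht ht0
    rw [ht, hJ, ← integral_complex_ofReal]
    refine integral_congr_ae ?_
    filter_upwards [(hmul t ht0).ae_eq_comp hf] with u hu
    rw [Complex.ofReal_mul]
    exact congrArg _ hu
  have hJpos : ∀ᵐ t ∂halfLine, 0 < J t := by
    filter_upwards [hint, ae_halfLine_pos] with t ht ht0
    exact integral_powerWeight_pos hF ht0 ht
  constructor
  · intro h0
    have hfalse : ∀ᵐ t ∂halfLine, False := by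
      filter_upwards [hJeq, hJpos, Lp.coeFn_zero ℂ p halfLine] with t h1 h2 h3
      rw [h0, h3] at h1
      exact h2.ne (Complex.ofReal_injective (by simpa using h1))
    have hvol := ae_iff.1 hfalse
    simp at hvol
  · rw [← le_inv_mul_iff₀ hκ0]
    refine Lp.norm_le_mul_norm_of_ae_le_mul ?_
    filter_upwards [hJeq, hJpos, hint, hk.ae_integrableOn (hw.averageLp f),
      hk.averageLp_ae_eq (hw.averageLp f), ae_halfLine_pos] with t h1 h2 h3 h4 h5 ht0
    have hae : (fun v => (dualCesaroWeight β v : ℂ) * hw.averageLp f (v * t)) =ᵐ[halfLine]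
        fun v => ((dualCesaroWeight β v * J (v * t) : ℝ) : ℂ) := by
      filter_upwards [(hmul t ht0).ae_eq_comp hJeq] with v hv
      rw [Complex.ofReal_mul]
      exact congrArg _ hv
    have hi : IntegrableOn (fun v => dualCesaroWeight β v * J (v * t)) (Ioi 0) := by
      have : IntegrableOn (fun v => ((dualCesaroWeight β v * J (v * t) : ℝ) : ℂ)) (Ioi 0) :=
        h4.congr hae
      exact this.re
    -- Expand `κ` as the integral of the dual weight against `v^(-a)` and compare integrands: on the
    -- support `v > 1` of the weight, `v^(-a) J(t) ≤ J(v t)`.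
    have hle : κ * J t ≤ ∫ v in Ioi 0, dualCesaroWeight β v * J (v * t) := by
      rw [← hκ, ← integral_mul_const]
      refine integral_mono_ae (hκi.mul_const _) hi ?_
      filter_upwards [(hmul t ht0).ae hint] with v hv
      rw [mul_assoc]
      by_cases hv1 : v ∈ Ioi (1 : ℝ)
      · refine mul_le_mul_of_nonneg_left ?_ (dualCesaroWeight_nonneg hβ v)
        rw [show -a = -1 - (a - 1) by ring]
        exact rpow_mul_integral_powerWeight_le hF ht0 (le_of_lt hv1) h3 hv
      · rw [dualCesaroWeight, indicator_of_notMem hv1, zero_mul, zero_mul]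
    rw [le_inv_mul_iff₀ hκ0, h5, integral_congr_ae hae, integral_complex_ofReal, h1,
      Complex.norm_real, Complex.norm_real, Real.norm_of_nonneg h2.le]
    exact hle.trans (le_abs_self _)

namespace SobolevT

theorem norm_average_dualCesaroWeight (hα : 0 ≤ α) (hβ : 0 < β)
    (hk : DilationWeight p (dualCesaroWeight β)) :
    ‖average α hk‖ =
      Real.Gamma (β + 1) * Real.Gamma (1 / p.toReal) / Real.Gamma (β + 1 / p.toReal) := by
  have hp0 : 0 < p.toReal := toReal_pos_of_one_le
  have ha : 0 < 1 / p.toReal := one_div_pos.2 hp0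
  refine le_antisymm ((norm_average_le hk).trans_eq (integral_norm_dualCesaroWeight hβ hp0)) ?_
  have hcont : ∀ x : ℝ, 0 < x → ContinuousAt Real.Gamma x := fun x hx =>
    (Real.differentiableAt_Gamma fun m => by
      have : (0 : ℝ) ≤ m := m.cast_nonneg
      linarith).continuousAt
  have hlim : Filter.Tendsto (fun ε => Real.Gamma (β + 1) * Real.Gamma (1 / p.toReal + ε) /
      Real.Gamma (β + (1 / p.toReal + ε))) (nhdsWithin 0 (Ioi 0))
      (nhds (Real.Gamma (β + 1) * Real.Gamma (1 / p.toReal + 0) /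
        Real.Gamma (β + (1 / p.toReal + 0)))) := by
    refine (ContinuousAt.div (continuousAt_const.mul ?_) ?_ ?_).tendsto.mono_left nhdsWithin_le_nhds
    · exact (hcont (1 / p.toReal + 0) (by linarith)).comp (f := fun ε => 1 / p.toReal + ε)
        (by fun_prop)
    · exact (hcont (β + (1 / p.toReal + 0)) (by linarith)).comp
        (f := fun ε => β + (1 / p.toReal + ε)) (by fun_prop)
    · exact (Real.Gamma_pos_of_pos (by linarith)).ne'
  rw [add_zero] at hlim
  -- The bound is proved at `a = 1/p + ε`; the shift `ε > 0` is what makes the truncated power an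
  -- admissible weight on `L^p`.
  refine le_of_tendsto hlim (eventually_mem_nhdsWithin.mono fun ε (hε : 0 < ε) => ?_)
  obtain ⟨f, hf⟩ := exists_D_ae_eq_rpow_mul_exp_neg hα hp.out
  have hw : DilationWeight p (powerWeight (1 / p.toReal + ε - 1)) := dilationWeight_powerWeight hε
  obtain ⟨h0, hle⟩ := mul_norm_powerWeight_average_le hβ (add_pos ha hε) (fun t ht => mul_pos
    (div_pos (Real.rpow_pos_of_pos ht α) (Real.Gamma_pos_of_pos (by linarith)))
    (Real.exp_pos (-t))) hf hk hw
  -- The test function is `D` of `average α hw f`, so its `L^p` norm is the norm of that element of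
  -- `𝒯_p^{(α)}(t^α)`.
  have hop : ‖hk.averageLp (hw.averageLp (D f))‖ ≤ ‖average α hk‖ * ‖hw.averageLp (D f)‖ :=
    (average α hk).le_opNorm (average α hw f)
  exact le_of_mul_le_mul_right (hle.trans hop) (norm_pos_iff.2 h0)

theorem isCesaro_average (hβ : 0 < β) (hk : DilationWeight p (cesaroWeight β)) :
    IsCesaro β (average α hk) := fun f => by
  filter_upwards [hk.ae_integrableOn (toLp f), hk.averageLp_ae_eq (toLp f), ae_halfLine_pos]
    with t h1 h2 ht
  obtain ⟨h3, h4⟩ := cesaro_integral_eq β (toLp f) ht h1 hβ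
  exact ⟨h3, h2.trans h4⟩

theorem isDualCesaro_average (hβ : 0 < β) (hk : DilationWeight p (dualCesaroWeight β)) :
    IsDualCesaro β (average α hk) := fun f => by
  filter_upwards [hk.ae_integrableOn (toLp f), hk.averageLp_ae_eq (toLp f), ae_halfLine_pos]
    with t h1 h2 ht
  obtain ⟨h3, h4⟩ := dualCesaro_integral_eq β (toLp f) ht h1 hβ
  exact ⟨h3, h2.trans h4⟩

end SobolevT

end

theorem mainTheorem2 (α β : ℝ) (hα : 0 ≤ α) (hβ : 0 < β)
    (p q : ℝ≥0∞) [Fact (1 ≤ p)] [Fact (1 ≤ q)] (hp : 1 < p) (hp_top : p ≠ ∞)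
    (hpq : 1 / p + 1 / q = 1) :
    (∃ S : SobolevT α p →L[ℂ] SobolevT α p, SobolevT.IsDualCesaro β S ∧
      ‖S‖ = Real.Gamma (β + 1) * Real.Gamma (1 / p.toReal) / Real.Gamma (β + 1 / p.toReal) ∧
      ∀ f : SobolevT α p, ∀ᵐ t ∂halfLine,
        IntegrableOn (fun r => (((Real.exp (-r) - 1) ^ (β - 1) *
          Real.exp (-r * (1 - 1 / p.toReal - β)) : ℝ) : ℂ) * dilation p.toReal r f t) (Iic 0) ∧
        S f t = (β : ℂ) * ∫ r in Iic (0 : ℝ), (((Real.exp (-r) - 1) ^ (β - 1) *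
          Real.exp (-r * (1 - 1 / p.toReal - β)) : ℝ) : ℂ) * dilation p.toReal r f t) ∧
    (∃ C : SobolevT α p →L[ℂ] SobolevT α p, ∃ S : SobolevT α q →L[ℂ] SobolevT α q,
      SobolevT.IsCesaro β C ∧ SobolevT.IsDualCesaro β S ∧
      ∀ (f : SobolevT α p) (g : SobolevT α q),
        SobolevT.pairing (C f) g = SobolevT.pairing f (S g)) := by
  have hconj : p.HolderConjugate q :=
    ENNReal.holderConjugate_iff.2 (by simpa only [one_div] using hpq)
  have : Fact (p ≠ ∞) := ⟨hp_top⟩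
  -- The conjugate exponent is finite because `p ≠ 1`.
  have : Fact (q ≠ ∞) := ⟨(ENNReal.HolderConjugate.ne_top_iff_ne_one q p).2 hp.ne'⟩
  have hkp : DilationWeight p (dualCesaroWeight β) :=
    dilationWeight_dualCesaroWeight hβ toReal_pos_of_one_le
  have hkq : DilationWeight q (dualCesaroWeight β) :=
    dilationWeight_dualCesaroWeight hβ toReal_pos_of_one_le
  have hc : DilationWeight p (cesaroWeight β) := dilationWeight_cesaroWeight hβ hp
  refine ⟨⟨SobolevT.average α hkp, SobolevT.isDualCesaro_average hβ hkp,
    SobolevT.norm_average_dualCesaroWeight hα hβ hkp, fun f => ?_⟩,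
    ⟨SobolevT.average α hc, SobolevT.average α hkq, SobolevT.isCesaro_average hβ hc,
      SobolevT.isDualCesaro_average hβ hkq, fun f g => ?_⟩⟩
  · filter_upwards [hkp.ae_integrableOn (SobolevT.toLp f), hkp.averageLp_ae_eq (SobolevT.toLp f)]
      with t h1 h2
    obtain ⟨h3, h4⟩ := dualCesaro_dilation_integral_eq p.toReal (SobolevT.toLp f) hβ h1
    exact ⟨h3, h2.trans h4⟩
  -- The pairing is the `L^p`–`L^q` pairing of `D f` and `D g`, and `D` commutes with averages by
  -- construction.
  · rw [SobolevT.pairing_eq hα, SobolevT.pairing_eq hα, SobolevT.D_average, SobolevT.D_average]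
    exact integral_averageLp_mul hc hkq (fun u hu => dualCesaroWeight_inv β hu) _ _
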